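/- For $n\ge 0$ let $\mathcal M_{2n}$ be the set of matchings of $[2n]=\{1,\dots,2n\}$, i.e. of partitions of $[2n]$ into $n$ two-element blocks. Each block $\{i,j\}$ with $i<j$ of a matching is regarded as an edge $(i,j)$. Two edges $(i_1,j_1)$, $(i_2,j_2)$ form a crossing if $i_1<i_2<j_1<j_2$ and a nesting if $i_1<i_2<j_2<j_1$; let $\mathrm{cr}(\alpha)$ and $\mathrm{ne}(\alpha)$ be the numbers of crossings and nestings of $\alpha\in\mathcal M_{2n}$. Put $$L_n(p,q)=\sum_{\alpha\in\mathcal M_{2n}}p^{\mathrm{cr}(\alpha)}q^{\mathrm{ne}(\alpha)},\qquad [k]_{p,q}=\frac{p^k-q^k}{p-q}=\sum_{i=0}^{k-1}p^iq^{k-1-i}.$$ Then, for indeterminates $p,q$ (equivalently, for arbitrary elements $p,q$ of any commutative ring $R$, with $[k]_{p,q}$ read as the polynomial), the following identity of formal power series in $z$ holds: $$\sum_{n\ge 0}L_n(p,q)\,z^n=\cfrac{1}{1-\cfrac{z}{1-\cfrac{[2]_{p,q}\,z}{1-\cfrac{[3]_{p,q}\,z}{1-\cfrac{[4]_{p,q}\,z}{\cdots}}}}}.$$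 That is, with $[1]_{p,q}=1$, the finite continued fractions $$\cfrac{1}{1-\cfrac{[1]_{p,q}\,z}{1-\cfrac{[2]_{p,q}\,z}{\ddots-\cfrac{\ddots}{1-[N]_{p,q}\,z}}}}$$ converge to the left-hand side as $N\to\infty$ in the sense of formal power series: for each $n$, the coefficient of $z^n$ equals $L_n(p,q)$ for all sufficiently large $N$. -/

import Mathlib

open scoped PowerSeries

namespace CrossNest

/-- The edges of a partition `π` of a finite set of integers: the pairs `(i, j)`, `i < j`, of
consecutive elements of a same block of `π`. -/
def edges {s : Finset ℕ} (π : Finpartition s) : Finset (ℕ × ℕ) :=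
  (s ×ˢ s).filter fun e =>
    e.1 < e.2 ∧ ∃ B ∈ π.parts, e.1 ∈ B ∧ e.2 ∈ B ∧ ∀ x ∈ B, ¬ (e.1 < x ∧ x < e.2)

/-- The number of crossings: pairs of edges `(i₁, j₁)`, `(i₂, j₂)` with `i₁ < i₂ < j₁ < j₂`. -/
def cr {s : Finset ℕ} (π : Finpartition s) : ℕ :=
  ((edges π ×ˢ edges π).filter fun e =>
    e.1.1 < e.2.1 ∧ e.2.1 < e.1.2 ∧ e.1.2 < e.2.2).card

/-- The number of nestings: pairs of edges `(i₁, j₁)`, `(i₂, j₂)` with `i₁ < i₂ < j₂ < j₁`. -/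
def ne {s : Finset ℕ} (π : Finpartition s) : ℕ :=
  ((edges π ×ˢ edges π).filter fun e =>
    e.1.1 < e.2.1 ∧ e.2.1 < e.2.2 ∧ e.2.2 < e.1.2).card

/-- The matchings of `[2n] = {1, …, 2n}`: the partitions of `[2n]` in `n` two-element blocks. -/
def matchings (n : ℕ) : Finset (Finpartition (Finset.Icc 1 (2 * n))) :=
  Finset.univ.filter fun α => α.parts.card = n ∧ ∀ B ∈ α.parts, B.card = 2

/-- `L_n(p, q)`, the sum of `p ^ cr α * q ^ ne α` over the matchings `α` of `[2n]`. -/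
def L {R : Type*} [CommRing R] (p q : R) (n : ℕ) : R :=
  ∑ α ∈ matchings n, p ^ cr α * q ^ ne α

/-- `[n]_{p,q} = (p ^ n - q ^ n) / (p - q)`, as the polynomial `∑_{i < n} p ^ i q ^ (n - 1 - i)`. -/
def pqNumber {R : Type*} [CommRing R] (p q : R) (n : ℕ) : R :=
  ∑ i ∈ Finset.range n, p ^ i * q ^ (n - 1 - i)

theorem pqNumber_mul_sub {R : Type*} [CommRing R] (p q : R) (n : ℕ) :
    pqNumber p q n * (p - q) = p ^ n - q ^ n :=
  (Commute.all p q).geom_sum₂_mul n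

theorem pqNumber_eq_div {K : Type*} [Field K] {p q : K} (h : p ≠ q) (n : ℕ) :
    pqNumber p q n = (p ^ n - q ^ n) / (p - q) := by
  rw [← pqNumber_mul_sub, mul_div_cancel_right₀ _ (sub_ne_zero.mpr h)]

/-- The convergents of the S-fraction `1 / (1 - c₀ z / (1 - c₁ z / (1 - c₂ z / ⋯)))` in `R⟦z⟧`:
the `N`-th one is `1 / (1 - c₀ z / (1 - c₁ z / (⋯ / (1 - c_{N-1} z))))`. -/
noncomputable def sFractionConvergent {R : Type*} [CommRing R] : ℕ → (ℕ → R) → R⟦X⟧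
  | 0, _ => 1
  | N + 1, c =>
      PowerSeries.invOfUnit
        (1 - PowerSeries.C (c 0) * PowerSeries.X * sFractionConvergent N (fun k => c (k + 1))) 1

/-- The power series inverted in the definition of the convergents is really invertible. -/
theorem mul_sFractionConvergent_succ {R : Type*} [CommRing R] (N : ℕ) (c : ℕ → R) :
    (1 - PowerSeries.C (c 0) * PowerSeries.X * sFractionConvergent N (fun k => c (k + 1))) *
      sFractionConvergent (N + 1) c = 1 := by
  rw [sFractionConvergent]
  exact PowerSeries.mul_invOfUnit _ 1 (by simp)

/-- `F = 1 / (1 - c₀ z / (1 - c₁ z / (1 - c₂ z / ⋯)))` in `R⟦z⟧`: the convergents tend to `F` in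
the sense of formal power series, i.e. each coefficient is eventually that of `F`. -/
def IsSFraction {R : Type*} [CommRing R] (F : R⟦X⟧) (c : ℕ → R) : Prop :=
  ∀ n : ℕ, ∀ᶠ N in Filter.atTop,
    PowerSeries.coeff n (sFractionConvergent N c) = PowerSeries.coeff n F

end CrossNest

namespace CrossNest

/-! Scan the points of the matching from left to right and keep the set `S` of open points, those
whose partner is still to come. The next point `t` either opens an edge or closes the one from some
`s` in `S`. When it closes `s`, the new edge crosses exactly the edges from the points of `S` after
`s` and is nested inside those from the points before `s`. Summing the resulting powers of `p` and
`q` over `s` gives `pqNumber p q S.card`, so only the number of open points matters, and `L p q n`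
is a sum over Dyck paths whose down steps from height `k` have weight `pqNumber p q k`
(`sum_edgeSets`, `L_eq_dyckSum`).

Path series from consecutive heights satisfy a three-term recurrence, whose successive quotients
unfold into the S-fraction. `X_pow_dvd_sub_sFractionConvergent` states this as a congruence modulo a
power of `X`, which gives the coefficients of the convergents (`coeff_sFractionConvergent`). -/

/-- The sum over the paths with `m` steps `±1` from height `h` to height `0` of the products of the
weights `d k` of the steps from `k` to `k - 1`. -/
def dyckSum {R : Type*} [CommRing R] (d : ℕ → R) : ℕ → ℕ → R
  | 0, h => if h = 0 then 1 else 0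
  | m + 1, h => dyckSum d m (h + 1) + d h * dyckSum d m (h - 1)

/-! ### Weighted Dyck paths and S-fractions -/

section SFraction

variable {R : Type*} [CommRing R]

theorem dyckSum_eq_zero_of_lt (d : ℕ → R) {m h : ℕ} (hm : m < h) : dyckSum d m h = 0 := by
  induction m generalizing h with
  | zero => simp [dyckSum, hm.ne']
  | succ m ih => rw [dyckSum, ih (by omega), ih (by omega)]; simp

/-- Congruences for a three-term recurrence of power series whose quotients form an S-fraction. -/
theorem X_pow_dvd_sub_sFractionConvergent (d : ℕ → R) (Q : ℕ → R⟦X⟧)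
    (hQ : ∀ h, Q (h + 1) = PowerSeries.X * Q (h + 2) + PowerSeries.C (d h) * Q h) (N h : ℕ) :
    (PowerSeries.X : R⟦X⟧) ^ (N + 1) ∣
      Q (h + 1) - PowerSeries.C (d h) * sFractionConvergent N (fun k => d (k + (h + 1))) * Q h := by
  induction N generalizing h with
  | zero => exact ⟨Q (h + 2), by rw [sFractionConvergent, hQ]; ring⟩
  | succ N ih =>
    obtain ⟨A, hA⟩ := ih (h + 1)
    have hF := mul_sFractionConvergent_succ N (fun k => d (k + (h + 1)))
    have hs : (fun k => d (k + 1 + (h + 1))) = fun k => d (k + (h + 1 + 1)) := by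
      funext k; congr 1; ring
    simp only [hs, zero_add] at hF
    set F := sFractionConvergent (N + 1) (fun k => d (k + (h + 1)))
    set F' := sFractionConvergent N (fun k => d (k + (h + 1 + 1)))
    refine ⟨F * A, ?_⟩
    have h1 := hQ h
    -- `hA` replaces `Q (h + 2)` by a multiple of `Q (h + 1)`; multiplying by `F`, the inverse of
    -- the resulting factor, avoids any division by a `Q` or a weight.
    linear_combination -Q (h + 1) * hF + F * h1 +
      F * PowerSeries.X * hA

theorem coeff_sFractionConvergent (d : ℕ → R) (hd : d 0 = 0) {n N : ℕ} (hN : n ≤ N) :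
    PowerSeries.coeff n (sFractionConvergent N fun k => d (k + 1)) = dyckSum d (2 * n) 0 := by
  -- The index is shifted by one: `Q (h + 1)` counts paths from height `h` by their number `m` of up
  -- steps.
  let Q : ℕ → R⟦X⟧ := fun
    | 0 => 1
    | h + 1 => PowerSeries.mk fun m => dyckSum d (2 * m + h) h
  -- The weight 1 at 0, with `Q 0 = 1`, makes the recurrence at `h = 0` supply the empty path.
  let d' : ℕ → R := fun h => if h = 0 then 1 else d h
  have hQ : ∀ h, Q (h + 1) = PowerSeries.X * Q (h + 2) + PowerSeries.C (d' h) * Q h := by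
    intro h
    ext m
    rcases h with _ | h <;> rcases m with _ | m
    · simp [Q, d', dyckSum]
    · simp only [Q, d', map_add, PowerSeries.coeff_succ_X_mul, PowerSeries.coeff_mk]
      -- In `dyckSum` the truncated `0 - 1` is `0`; `hd` kills this spurious down step.
      rw [show 2 * (m + 1) + 0 = (2 * m + (0 + 1)) + 1 by ring, dyckSum, hd]
      simp [PowerSeries.coeff_one]
    · simp only [Q, d', map_add, PowerSeries.coeff_zero_X_mul, PowerSeries.coeff_C_mul,
        PowerSeries.coeff_mk]
      rw [show 2 * 0 + (h + 1) = (2 * 0 + h) + 1 by ring, dyckSum,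
        dyckSum_eq_zero_of_lt d (by omega)]
      simp
    · simp only [Q, d', map_add, PowerSeries.coeff_succ_X_mul, PowerSeries.coeff_C_mul,
        PowerSeries.coeff_mk]
      rw [show 2 * (m + 1) + (h + 1) = (2 * m + (h + 1 + 1)) + 1 by ring, dyckSum,
        show 2 * (m + 1) + h = 2 * m + (h + 1 + 1) by ring]
      simp
  have h := PowerSeries.X_pow_dvd_iff.1 (X_pow_dvd_sub_sFractionConvergent d' Q hQ N 0) n (by omega)
  simp only [Q, d', map_sub, PowerSeries.coeff_mk, sub_eq_zero] at h
  simpa using h.symm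

end SFraction

/-! ### Partial matchings with a set of open points -/

section EdgeSets

/-- `E` is the set of edges of a matching of `S ∪ T` in which each edge ends in `T`. -/
def IsEdgeSet (S T : Finset ℕ) (E : Finset (ℕ × ℕ)) : Prop :=
  (∀ e ∈ E, e.1 < e.2 ∧ e.1 ∈ S ∪ T ∧ e.2 ∈ T) ∧
    ∀ x ∈ S ∪ T, ∃ e ∈ E, (x = e.1 ∨ x = e.2) ∧ ∀ e' ∈ E, (x = e'.1 ∨ x = e'.2) → e' = e

open Classical in
/-- The edge sets of matchings of `S ∪ T` in which each edge ends in `T`. -/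
noncomputable def edgeSets (S T : Finset ℕ) : Finset (Finset (ℕ × ℕ)) :=
  ((S ∪ T) ×ˢ T).powerset.filter fun E => IsEdgeSet S T E

theorem mem_edgeSets {S T : Finset ℕ} {E : Finset (ℕ × ℕ)} :
    E ∈ edgeSets S T ↔ IsEdgeSet S T E := by
  simp only [edgeSets, Finset.mem_filter, Finset.mem_powerset, and_iff_right_iff_imp]
  intro h e he
  exact Finset.mem_product.2 (h.1 e he).2

theorem IsEdgeSet.eq_of_mem {S T : Finset ℕ} {E : Finset (ℕ × ℕ)} (h : IsEdgeSet S T E)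
    {e e' : ℕ × ℕ} (he : e ∈ E) (he' : e' ∈ E) {x : ℕ} (hx : x = e.1 ∨ x = e.2)
    (hx' : x = e'.1 ∨ x = e'.2) : e = e' := by
  have hxU : x ∈ S ∪ T := by
    have := h.1 e he
    rcases hx with rfl | rfl
    · exact this.2.1
    · exact Finset.mem_union_right _ this.2.2
  obtain ⟨f, -, -, hf⟩ := h.2 x hxU
  rw [hf e he hx, hf e' he' hx']

/-- The number of crossings in a set of edges. -/
def crossings (E : Finset (ℕ × ℕ)) : ℕ :=
  ((E ×ˢ E).filter fun e => e.1.1 < e.2.1 ∧ e.2.1 < e.1.2 ∧ e.1.2 < e.2.2).card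

/-- The number of nestings in a set of edges. -/
def nestings (E : Finset (ℕ × ℕ)) : ℕ :=
  ((E ×ˢ E).filter fun e => e.1.1 < e.2.1 ∧ e.2.1 < e.2.2 ∧ e.2.2 < e.1.2).card

section Recurrence

variable {S T : Finset ℕ} {t : ℕ}

theorem isEdgeSet_insert_left (hT : ∀ x ∈ T, t < x)
    {E : Finset (ℕ × ℕ)} :
    IsEdgeSet (insert t S) T E ↔ IsEdgeSet S (insert t T) E ∧ ∀ e ∈ E, e.2 ≠ t := by
  have hU : insert t S ∪ T = S ∪ insert t T := by
    ext; simp only [Finset.mem_union, Finset.mem_insert]; tauto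
  unfold IsEdgeSet
  rw [hU]
  constructor
  · rintro ⟨h1, h2⟩
    exact ⟨⟨fun e he => ⟨(h1 e he).1, (h1 e he).2.1, Finset.mem_insert_of_mem (h1 e he).2.2⟩, h2⟩,
      fun e he => (hT _ (h1 e he).2.2).ne'⟩
  · rintro ⟨⟨h1, h2⟩, h3⟩
    exact ⟨fun e he => ⟨(h1 e he).1, (h1 e he).2.1,
      (Finset.mem_insert.1 (h1 e he).2.2).resolve_left (h3 e he)⟩, h2⟩

theorem IsEdgeSet.insert_edge (hS : ∀ s ∈ S, s < t) (hT : ∀ x ∈ T, t < x) {s : ℕ} (hs : s ∈ S)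
    {E : Finset (ℕ × ℕ)} (h : IsEdgeSet (S.erase s) T E) :
    IsEdgeSet S (insert t T) (insert (s, t) E) := by
  have hst := hS s hs
  have hne : ∀ e ∈ E, e.1 ≠ s ∧ e.1 ≠ t ∧ e.2 ≠ s ∧ e.2 ≠ t := by
    intro e he
    obtain ⟨-, h1, h2⟩ := h.1 e he
    have h2 := hT _ h2
    rcases Finset.mem_union.1 h1 with h1 | h1
    · have h3 := hS _ (Finset.mem_of_mem_erase h1)
      have h4 := Finset.ne_of_mem_erase h1
      omega
    · have h3 := hT _ h1
      omega
  constructor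
  · intro e he
    rcases Finset.mem_insert.1 he with rfl | he
    · simp [hst, hs]
    · obtain ⟨h0, h1, h2⟩ := h.1 e he
      refine ⟨h0, ?_, Finset.mem_insert_of_mem h2⟩
      simp only [Finset.mem_union, Finset.mem_erase, Finset.mem_insert] at h1 ⊢
      tauto
  · intro x hx
    by_cases hxs : x = s ∨ x = t
    · refine ⟨(s, t), Finset.mem_insert_self _ _, hxs, fun e he hxe => ?_⟩
      rcases Finset.mem_insert.1 he with rfl | he
      · rfl
      · have := hne e he
        omega
    · obtain ⟨e, he, hxe, hu⟩ := h.2 x (by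
        simp only [Finset.mem_union, Finset.mem_erase, Finset.mem_insert] at hx ⊢
        tauto)
      refine ⟨e, Finset.mem_insert_of_mem he, hxe, fun e' he' hxe' => ?_⟩
      rcases Finset.mem_insert.1 he' with rfl | he'
      · exact absurd hxe' hxs
      · exact hu e' he' hxe'

theorem IsEdgeSet.erase_edge (hS : ∀ s ∈ S, s < t) (hT : ∀ x ∈ T, t < x) {s : ℕ}
    {E : Finset (ℕ × ℕ)} (h : IsEdgeSet S (insert t T) E) (hE : (s, t) ∈ E) :
    s ∈ S ∧ IsEdgeSet (S.erase s) T (E.erase (s, t)) := by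
  have hst : s < t := (h.1 _ hE).1
  have hs : s ∈ S := by
    have := (h.1 _ hE).2.1
    simp only [Finset.mem_union, Finset.mem_insert] at this
    rcases this with h1 | h1 | h1
    · exact h1
    · omega
    · have := hT _ h1
      omega
  have hne : ∀ e ∈ E, e ≠ (s, t) → e.1 ≠ s ∧ e.1 ≠ t ∧ e.2 ≠ s ∧ e.2 ≠ t := by
    intro e he hne
    refine ⟨fun h' => hne ?_, fun h' => hne ?_, fun h' => hne ?_, fun h' => hne ?_⟩
    · exact h.eq_of_mem he hE (.inl rfl) (.inl h')
    · exact h.eq_of_mem he hE (.inl rfl) (.inr h')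
    · exact h.eq_of_mem he hE (.inr rfl) (.inl h')
    · exact h.eq_of_mem he hE (.inr rfl) (.inr h')
  refine ⟨hs, fun e he => ?_, fun x hx => ?_⟩
  · obtain ⟨he0, he⟩ := Finset.mem_erase.1 he
    obtain ⟨h0, h1, h2⟩ := h.1 e he
    have := hne e he he0
    simp only [Finset.mem_union, Finset.mem_erase, Finset.mem_insert] at h1 h2 ⊢
    tauto
  · have hx' : x ≠ s ∧ x ≠ t := by
      rcases Finset.mem_union.1 hx with hx | hx
      · exact ⟨Finset.ne_of_mem_erase hx, (hS _ (Finset.mem_of_mem_erase hx)).ne⟩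
      · have := hT _ hx
        omega
    obtain ⟨e, he, hxe, hu⟩ := h.2 x (by
      simp only [Finset.mem_union, Finset.mem_erase, Finset.mem_insert] at hx ⊢
      tauto)
    refine ⟨e, Finset.mem_erase.2 ⟨?_, he⟩, hxe, fun e' he' => hu e' (Finset.mem_of_mem_erase he')⟩
    rintro rfl
    exact hxe.elim hx'.1 hx'.2

/-- If `t` closes an edge, its partner lies in `S`, since every point of `T` is to the right of `t`;
removing that edge leaves a smaller configuration. -/
theorem edgeSets_insert (hS : ∀ s ∈ S, s < t) (hT : ∀ x ∈ T, t < x) :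
    edgeSets S (insert t T) = edgeSets (insert t S) T ∪
      S.biUnion fun s => (edgeSets (S.erase s) T).image (insert (s, t)) := by
  ext E
  simp only [Finset.mem_union, Finset.mem_biUnion, Finset.mem_image, mem_edgeSets,
    isEdgeSet_insert_left hT]
  constructor
  · intro h
    by_cases h' : ∀ e ∈ E, e.2 ≠ t
    · exact .inl ⟨h, h'⟩
    · push Not at h'
      obtain ⟨⟨s, t'⟩, he, rfl⟩ := h'
      obtain ⟨hs, h'⟩ := h.erase_edge hS hT he
      exact .inr ⟨s, hs, _, h', Finset.insert_erase he⟩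
  · rintro (h | ⟨s, hs, E', h, rfl⟩)
    · exact h.1
    · exact h.insert_edge hS hT hs

theorem IsEdgeSet.notMem_edge {s : ℕ} {S : Finset ℕ} (hT : ∀ x ∈ T, t < x)
    {E : Finset (ℕ × ℕ)} (h : IsEdgeSet S T E) : (s, t) ∉ E := fun he =>
  (hT _ (h.1 _ he).2.2).ne rfl

/-- Each point of `S` is the left end of an edge, so edges are counted by their left ends. -/
theorem IsEdgeSet.card_filter_fst (hST : ∀ s ∈ S, ∀ x ∈ T, s < x)
    (hT : ∀ x ∈ T, t < x) {E : Finset (ℕ × ℕ)} (h : IsEdgeSet S T E)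
    (P : ℕ → Prop) [DecidablePred P] (hP : ∀ x, P x → x < t) :
    (E.filter fun e => P e.1).card = (S.filter P).card := by
  refine Finset.card_bij (fun e _ => e.1) ?_ ?_ ?_
  · intro e he
    obtain ⟨he, hp⟩ := Finset.mem_filter.1 he
    refine Finset.mem_filter.2 ⟨?_, hp⟩
    have := hP _ hp
    rcases Finset.mem_union.1 (h.1 e he).2.1 with h1 | h1
    · exact h1
    · have := hT _ h1
      omega
  · intro e he e' he' hee
    exact h.eq_of_mem (Finset.mem_filter.1 he).1 (Finset.mem_filter.1 he').1 (.inl rfl) (.inl hee)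
  · intro x hx
    obtain ⟨hx, hp⟩ := Finset.mem_filter.1 hx
    obtain ⟨e, he, hxe, -⟩ := h.2 x (Finset.mem_union_left _ hx)
    have hxe : x = e.1 := by
      rcases hxe with h1 | h1
      · exact h1
      · exact absurd (hST x hx _ (h.1 e he).2.2) (by omega)
    exact ⟨e, Finset.mem_filter.2 ⟨he, hxe ▸ hp⟩, hxe.symm⟩

/-- All other edges end after `t`, so `(s, t)` can only be the first edge of a crossing, and it
crosses exactly the edges starting between `s` and `t`. -/
theorem IsEdgeSet.crossings_insert (hS : ∀ s ∈ S, s < t) (hT : ∀ x ∈ T, t < x) {s : ℕ} (hs : s ∈ S)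
    {E : Finset (ℕ × ℕ)} (h : IsEdgeSet (S.erase s) T E) :
    crossings (insert (s, t) E) = (S.filter (s < ·)).card + crossings E := by
  have hst := hS s hs
  have hE : ∀ e ∈ E, t < e.2 := fun e he => hT _ (h.1 e he).2.2
  have hcard := h.card_filter_fst (t := t) (fun x hx y hy =>
    (hS x (Finset.mem_of_mem_erase hx)).trans (hT y hy)) hT
    (fun x => s < x ∧ x < t) (fun x hx => hx.2)
  have hS' : (S.erase s).filter (fun x => s < x ∧ x < t) = S.filter (s < ·) := by
    ext x
    simp only [Finset.mem_filter, Finset.mem_erase]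
    constructor
    · tauto
    · rintro ⟨h1, h2⟩
      exact ⟨⟨h2.ne', h1⟩, h2, hS x h1⟩
  rw [hS'] at hcard
  rw [← hcard, crossings, crossings,
    ← Finset.card_image_of_injective (E.filter _) (Prod.mk_right_injective (s, t)),
    ← Finset.card_union_of_disjoint]
  · congr 1
    ext ⟨⟨a, b⟩, ⟨c, d⟩⟩
    simp only [Finset.mem_filter, Finset.mem_product, Finset.mem_insert, Finset.mem_union,
      Finset.mem_image, Prod.mk.injEq]
    constructor
    · rintro ⟨⟨⟨rfl, rfl⟩ | h1, ⟨rfl, rfl⟩ | h2⟩, h3⟩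
      · omega
      · exact .inl ⟨(c, d), ⟨h2, h3.1, h3.2.1⟩, ⟨rfl, rfl⟩, rfl⟩
      · have := hE _ h1
        simp only at this h3
        omega
      · exact .inr ⟨⟨h1, h2⟩, h3⟩
    · rintro (⟨⟨c', d'⟩, ⟨h1, h2⟩, ⟨rfl, rfl⟩, h3⟩ | h1)
      · obtain ⟨rfl, rfl⟩ := Prod.mk.inj h3
        exact ⟨⟨.inl ⟨rfl, rfl⟩, .inr h1⟩, h2.1, h2.2, hE _ h1⟩
      · exact ⟨⟨.inr h1.1.1, .inr h1.1.2⟩, h1.2⟩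
  · rw [Finset.disjoint_left]
    rintro ⟨e, e'⟩ h1 h2
    obtain ⟨f, -, hf⟩ := Finset.mem_image.1 h1
    obtain ⟨rfl, rfl⟩ := Prod.mk.inj hf
    exact h.notMem_edge hT (Finset.mem_product.1 (Finset.mem_filter.1 h2).1).1

/-- Since `t` precedes all other right ends, `(s, t)` can only be the inner edge of a nesting; the
outer ones start before `s`. -/
theorem IsEdgeSet.nestings_insert (hS : ∀ s ∈ S, s < t) (hT : ∀ x ∈ T, t < x) {s : ℕ} (hs : s ∈ S)
    {E : Finset (ℕ × ℕ)} (h : IsEdgeSet (S.erase s) T E) :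
    nestings (insert (s, t) E) = (S.filter (· < s)).card + nestings E := by
  have hst := hS s hs
  have hE : ∀ e ∈ E, t < e.2 := fun e he => hT _ (h.1 e he).2.2
  have hcard := h.card_filter_fst (t := t) (fun x hx y hy =>
    (hS x (Finset.mem_of_mem_erase hx)).trans (hT y hy)) hT
    (fun x => x < s) (fun x hx => hx.trans hst)
  have hS' : (S.erase s).filter (fun x => x < s) = S.filter (· < s) := by
    ext x
    simp only [Finset.mem_filter, Finset.mem_erase]
    exact ⟨fun h => ⟨h.1.2, h.2⟩, fun h => ⟨⟨h.2.ne, h.1⟩, h.2⟩⟩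
  rw [hS'] at hcard
  rw [← hcard, nestings, nestings,
    ← Finset.card_image_of_injective (E.filter _) (Prod.mk_left_injective (s, t)),
    ← Finset.card_union_of_disjoint]
  · congr 1
    ext ⟨⟨a, b⟩, ⟨c, d⟩⟩
    simp only [Finset.mem_filter, Finset.mem_product, Finset.mem_insert, Finset.mem_union,
      Finset.mem_image, Prod.mk.injEq]
    constructor
    · rintro ⟨⟨⟨rfl, rfl⟩ | h1, ⟨rfl, rfl⟩ | h2⟩, h3⟩
      · omega
      · have := hE _ h2
        simp only at this h3
        omega
      · exact .inl ⟨(a, b), ⟨h1, h3.1⟩, rfl, rfl, rfl⟩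
      · exact .inr ⟨⟨h1, h2⟩, h3⟩
    · rintro (⟨⟨a', b'⟩, ⟨h1, h2⟩, h3, ⟨rfl, rfl⟩⟩ | h1)
      · obtain ⟨rfl, rfl⟩ := Prod.mk.inj h3
        exact ⟨⟨.inr h1, .inl ⟨rfl, rfl⟩⟩, h2, hst, hE _ h1⟩
      · exact ⟨⟨.inr h1.1.1, .inr h1.1.2⟩, h1.2⟩
  · rw [Finset.disjoint_left]
    rintro ⟨e, e'⟩ h1 h2
    obtain ⟨f, -, hf⟩ := Finset.mem_image.1 h1
    obtain ⟨rfl, rfl⟩ := Prod.mk.inj hf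
    exact h.notMem_edge hT (Finset.mem_product.1 (Finset.mem_filter.1 h2).1).2

end Recurrence

variable {R : Type*} [CommRing R] (p q : R)

theorem pqNumber_succ (n : ℕ) : pqNumber p q (n + 1) = p * pqNumber p q n + q ^ n := by
  rw [pqNumber, Finset.sum_range_succ', pqNumber, Finset.mul_sum]
  congr 1
  · refine Finset.sum_congr rfl fun i _ => ?_
    rw [show n + 1 - 1 - (i + 1) = n - 1 - i by omega]
    ring
  · simp

/-- A new maximum multiplies each old term by `p` and contributes `q ^ S.card` itself, as in
`pqNumber_succ`. -/
theorem sum_pow_card_filter_lt (S : Finset ℕ) :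
    ∑ s ∈ S, p ^ (S.filter (s < ·)).card * q ^ (S.filter (· < s)).card = pqNumber p q S.card := by
  induction S using Finset.induction_on_max with
  | empty => simp [pqNumber]
  | insert a S ha ih =>
    have haS : a ∉ S := fun h => lt_irrefl _ (ha a h)
    rw [Finset.sum_insert haS, Finset.card_insert_of_notMem haS, pqNumber_succ, ← ih, add_comm,
      Finset.mul_sum]
    congr 1
    · refine Finset.sum_congr rfl fun s hs => ?_
      rw [Finset.filter_insert, if_pos (ha s hs), Finset.filter_insert, if_neg (ha s hs).not_gt,
        Finset.card_insert_of_notMem (fun h => haS (Finset.mem_filter.1 h).1)]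
      ring
    · rw [Finset.filter_insert, if_neg (lt_irrefl a), Finset.filter_insert, if_neg (lt_irrefl a),
        Finset.filter_true_of_mem ha,
        Finset.filter_false_of_mem (fun x hx => (ha x hx).not_gt)]
      simp

theorem sum_edgeSets (S T : Finset ℕ) (hST : ∀ s ∈ S, ∀ t ∈ T, s < t) :
    ∑ E ∈ edgeSets S T, p ^ crossings E * q ^ nestings E =
      dyckSum (pqNumber p q) T.card S.card := by
  -- `S` must vary: it gains `t` when `t` opens an edge and loses `s` when `t` closes one.
  induction T using Finset.induction_on_min generalizing S with
  | empty =>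
    have h : edgeSets S ∅ = if S = ∅ then {∅} else ∅ := by
      ext E
      rw [mem_edgeSets]
      have hE : IsEdgeSet S ∅ E → E = ∅ := fun h =>
        Finset.eq_empty_of_forall_notMem fun e he => by simpa using (h.1 e he).2.2
      split_ifs with hS
      · subst hS
        rw [Finset.mem_singleton]
        refine ⟨hE, ?_⟩
        rintro rfl
        simp [IsEdgeSet]
      · simp only [Finset.notMem_empty, iff_false]
        intro h
        obtain ⟨s, hs⟩ := Finset.nonempty_iff_ne_empty.2 hS
        obtain ⟨e, he, -⟩ := h.2 s (Finset.mem_union_left _ hs)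
        simp [hE h] at he
    rw [h, Finset.card_empty, dyckSum]
    simp only [Finset.card_eq_zero]
    split_ifs <;> simp [crossings, nestings]
  | insert t T ht ih =>
    have hS : ∀ s ∈ S, s < t := fun s hs => hST s hs t (Finset.mem_insert_self _ _)
    have htT : t ∉ T := fun h => lt_irrefl _ (ht t h)
    have htS : t ∉ S := fun h => lt_irrefl _ (hS t h)
    have hST' : ∀ s ∈ S, ∀ x ∈ T, s < x := fun s hs x hx => (hS s hs).trans (ht x hx)
    rw [edgeSets_insert hS ht, Finset.sum_union, Finset.sum_biUnion,
      Finset.card_insert_of_notMem htT, dyckSum, ih (insert t S), Finset.card_insert_of_notMem htS]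
    · congr 1
      rw [← sum_pow_card_filter_lt, Finset.sum_mul]
      refine Finset.sum_congr rfl fun s hs => ?_
      rw [Finset.sum_image, ← Finset.card_erase_of_mem hs,
        ← ih (S.erase s) fun x hx => hST' x (Finset.mem_of_mem_erase hx), Finset.mul_sum]
      · refine Finset.sum_congr rfl fun E hE => ?_
        rw [mem_edgeSets] at hE
        rw [hE.crossings_insert hS ht hs, hE.nestings_insert hS ht hs]
        ring
      · intro E hE E' hE' h
        have h1 := (mem_edgeSets.1 hE).notMem_edge (s := s) ht
        have h2 := (mem_edgeSets.1 hE').notMem_edge (s := s) ht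
        rw [← Finset.erase_insert h1, ← Finset.erase_insert h2]
        exact congrArg (fun E => Finset.erase E (s, t)) h
    · intro x hx y hy
      rcases Finset.mem_insert.1 hx with rfl | hx
      · exact ht y hy
      · exact hST' x hx y hy
    · intro s hs s' hs' hss
      rw [Function.onFun, Finset.disjoint_left]
      intro F hF hF'
      obtain ⟨E, hE, rfl⟩ := Finset.mem_image.1 hF
      obtain ⟨E', hE', h⟩ := Finset.mem_image.1 hF'
      have : (s, t) ∈ insert (s', t) E' := h ▸ Finset.mem_insert_self _ _
      rcases Finset.mem_insert.1 this with h1 | h1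
      · exact hss (Prod.mk.inj h1).1
      · exact (mem_edgeSets.1 hE').notMem_edge ht h1
    · rw [Finset.disjoint_left]
      intro F hF hF'
      obtain ⟨s, -, hF'⟩ := Finset.mem_biUnion.1 hF'
      obtain ⟨E, -, rfl⟩ := Finset.mem_image.1 hF'
      exact (mem_edgeSets.1 hF).notMem_edge ht (Finset.mem_insert_self _ _)

end EdgeSets

/-! ### Matchings as edge sets without initial open points -/

section Matchings

variable {s : Finset ℕ}

theorem mem_edges_iff {π : Finpartition s} (hπ : ∀ B ∈ π.parts, B.card = 2) {e : ℕ × ℕ} :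
    e ∈ edges π ↔ e.1 < e.2 ∧ {e.1, e.2} ∈ π.parts := by
  simp only [edges, Finset.mem_filter, Finset.mem_product]
  constructor
  · rintro ⟨-, h, B, hB, h1, h2, -⟩
    refine ⟨h, ?_⟩
    rwa [Finset.eq_of_subset_of_card_le (s := {e.1, e.2}) (t := B)]
    · simp [Finset.insert_subset_iff, h1, h2]
    · rw [hπ B hB, Finset.card_pair h.ne]
  · rintro ⟨h, hB⟩
    refine ⟨⟨π.le hB (by simp), π.le hB (by simp)⟩, h, _, hB, by simp, by simp, ?_⟩
    intro x hx
    simp only [Finset.mem_insert, Finset.mem_singleton] at hx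
    omega

theorem exists_lt_of_card_eq_two {B : Finset ℕ} (hB : B.card = 2) : ∃ i j, i < j ∧ B = {i, j} := by
  obtain ⟨x, y, hxy, rfl⟩ := Finset.card_eq_two.1 hB
  rcases hxy.lt_or_gt with h | h
  · exact ⟨x, y, h, rfl⟩
  · exact ⟨y, x, h, Finset.pair_comm x y⟩

theorem pair_injective_of_lt {e e' : ℕ × ℕ} (he : e.1 < e.2) (he' : e'.1 < e'.2)
    (h : ({e.1, e.2} : Finset ℕ) = {e'.1, e'.2}) : e = e' := by
  have h1 : e.1 ∈ ({e'.1, e'.2} : Finset ℕ) := h ▸ by simp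
  have h2 : e.2 ∈ ({e'.1, e'.2} : Finset ℕ) := h ▸ by simp
  simp only [Finset.mem_insert, Finset.mem_singleton] at h1 h2
  ext <;> omega

theorem isEdgeSet_edges {π : Finpartition s} (hπ : ∀ B ∈ π.parts, B.card = 2) :
    IsEdgeSet ∅ s (edges π) := by
  refine ⟨fun e he => ?_, fun x hx => ?_⟩
  · obtain ⟨h, hB⟩ := (mem_edges_iff hπ).1 he
    exact ⟨h, by simpa using π.le hB (show e.1 ∈ _ by simp), π.le hB (by simp)⟩
  · rw [Finset.empty_union] at hx
    obtain ⟨B, hB, hxB⟩ := π.exists_mem hx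
    obtain ⟨i, j, hij, rfl⟩ := exists_lt_of_card_eq_two (hπ B hB)
    refine ⟨(i, j), (mem_edges_iff hπ).2 ⟨hij, hB⟩, by simpa using hxB, fun e he hxe => ?_⟩
    obtain ⟨h, hB'⟩ := (mem_edges_iff hπ).1 he
    exact pair_injective_of_lt h hij (π.eq_of_mem_parts hB' hB (by simpa using hxe) hxB)

theorem parts_eq_image_edges {π : Finpartition s} (hπ : ∀ B ∈ π.parts, B.card = 2) :
    π.parts = (edges π).image fun e => {e.1, e.2} := by
  ext B
  rw [Finset.mem_image]
  constructor
  · intro hB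
    obtain ⟨i, j, hij, rfl⟩ := exists_lt_of_card_eq_two (hπ B hB)
    exact ⟨(i, j), (mem_edges_iff hπ).2 ⟨hij, hB⟩, rfl⟩
  · rintro ⟨e, he, rfl⟩
    exact ((mem_edges_iff hπ).1 he).2

theorem IsEdgeSet.exists_finpartition {E : Finset (ℕ × ℕ)} (h : IsEdgeSet ∅ s E) :
    ∃ π : Finpartition s, (∀ B ∈ π.parts, B.card = 2) ∧ edges π = E := by
  have hparts : ∀ B ∈ E.image (fun e => ({e.1, e.2} : Finset ℕ)), B.card = 2 := by
    intro B hB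
    obtain ⟨e, he, rfl⟩ := Finset.mem_image.1 hB
    exact Finset.card_pair (h.1 e he).1.ne
  have hsub : ∀ B ∈ E.image (fun e => ({e.1, e.2} : Finset ℕ)), B ⊆ s := by
    intro B hB
    obtain ⟨e, he, rfl⟩ := Finset.mem_image.1 hB
    obtain ⟨-, h1, h2⟩ := h.1 e he
    rw [Finset.empty_union] at h1
    exact Finset.insert_subset h1 (Finset.singleton_subset_iff.2 h2)
  have huniq : ∀ x ∈ s, ∃! B, B ∈ E.image (fun e => ({e.1, e.2} : Finset ℕ)) ∧ x ∈ B := by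
    intro x hx
    obtain ⟨e, he, hxe, hu⟩ := h.2 x (by simpa using hx)
    refine ⟨{e.1, e.2}, ⟨Finset.mem_image.2 ⟨e, he, rfl⟩, by simpa using hxe⟩, ?_⟩
    rintro B ⟨hB, hxB⟩
    obtain ⟨e', he', rfl⟩ := Finset.mem_image.1 hB
    rw [hu e' he' (by simpa using hxB)]
  have hbot : ∅ ∉ E.image (fun e => ({e.1, e.2} : Finset ℕ)) := fun h0 => by
    simpa using hparts _ h0
  obtain ⟨π, hπ⟩ : ∃ π : Finpartition s, π.parts = E.image fun e => {e.1, e.2} :=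
    ⟨Finpartition.ofExistsUnique _ hsub huniq hbot, rfl⟩
  rw [← hπ] at hparts
  refine ⟨π, hparts, ?_⟩
  ext e
  rw [mem_edges_iff hparts, hπ]
  constructor
  · rintro ⟨h1, h2⟩
    obtain ⟨e', he', h3⟩ := Finset.mem_image.1 h2
    rwa [← pair_injective_of_lt (h.1 e' he').1 h1 h3]
  · intro he
    exact ⟨(h.1 e he).1, Finset.mem_image.2 ⟨e, he, rfl⟩⟩

theorem mem_matchings {n : ℕ} {π : Finpartition (Finset.Icc 1 (2 * n))} :
    π ∈ matchings n ↔ ∀ B ∈ π.parts, B.card = 2 := by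
  simp only [matchings, Finset.mem_filter, Finset.mem_univ, true_and, and_iff_right_iff_imp]
  intro h
  -- Blocks of size 2 covering `2 * n` points force the number of blocks to be `n`.
  have := π.sum_card_parts
  rw [Finset.sum_congr rfl h, Finset.sum_const, Nat.card_Icc, smul_eq_mul] at this
  omega

theorem L_eq_dyckSum {R : Type*} [CommRing R] (p q : R) (n : ℕ) :
    L p q n = dyckSum (pqNumber p q) (2 * n) 0 := by
  have h := sum_edgeSets p q ∅ (Finset.Icc 1 (2 * n)) (by simp)
  rw [Finset.card_empty, Nat.card_Icc, Nat.add_sub_cancel] at h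
  rw [← h, L]
  refine Finset.sum_bij (fun π _ => edges π) ?_ ?_ ?_ fun _ _ => rfl
  · intro π hπ
    exact mem_edgeSets.2 (isEdgeSet_edges (mem_matchings.1 hπ))
  · intro π hπ π' hπ' heq
    ext1
    rw [parts_eq_image_edges (mem_matchings.1 hπ), parts_eq_image_edges (mem_matchings.1 hπ'), heq]
  · intro E hE
    obtain ⟨π, hπ, rfl⟩ := (mem_edgeSets.1 hE).exists_finpartition
    exact ⟨π, mem_matchings.2 hπ, rfl⟩

end Matchings

end CrossNest

theorem mainTheorem10 {R : Type*} [CommRing R] (p q : R) :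
    CrossNest.IsSFraction (PowerSeries.mk fun n => CrossNest.L p q n)
      (fun k => CrossNest.pqNumber p q (k + 1)) := by
  intro n
  filter_upwards [Filter.eventually_ge_atTop n] with N hN
  rw [CrossNest.coeff_sFractionConvergent (CrossNest.pqNumber p q) (by simp [CrossNest.pqNumber])
    hN, PowerSeries.coeff_mk, CrossNest.L_eq_dyckSum]
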